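/- **Programs.** Let $\mathcal N$ be a countable set of variables. A state $\sigma$ is a finite set $\mathrm{dom}(\sigma)\subseteq\mathcal N$ together with a real value $\sigma(x)$ for each $x\in\mathrm{dom}(\sigma)$; the set $\Omega$ of states carries the Borel $\sigma$-algebra of the metric $d(\sigma,\tau)=\sum_{x\in\mathrm{dom}(\sigma)}|\sigma(x)-\tau(x)|$ if $\mathrm{dom}(\sigma)=\mathrm{dom}(\tau)$, and $d(\sigma,\tau)=\infty$ otherwise. Programs are given by $$C ::= \mathtt{skip}\mid \mathtt{diverge}\mid x:=E\mid x:\approx U\mid \mathtt{observe}(\phi)\mid \mathtt{score}(E)\mid C;C\mid \mathtt{if}(\phi)\{C\}\mid\mathtt{while}(\phi)\{C\},$$ where the expressions $E$ and predicates $\phi$ come from an arbitrary syntax with total measurable evaluation functions $\sigma\mapsto\sigma(E)\in\mathbb R$ and $\sigma\mapsto\sigma(\phi)\in\{\mathtt{true},\mathtt{false}\}$. In runs, sequential composition is associative: a sequence is a list of statements that are not themselves sequences. **Weakest liberal preexpectation.** For measurable $f:\Omega\to[0,1]$, $\mathtt{wlp}[\![C]\!](f):\Omega\to[0,1]$ is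 defined by recursion on $C$: - $\mathtt{skip}$: $f$; $\mathtt{diverge}$: the constant $1$; $x:=E$: $\sigma\mapsto f(\sigma[x\mapsto\sigma(E)])$; - $x:\approx U$: $\sigma\mapsto\int_{[0,1]}f(\sigma[x\mapsto v])\,dv$; $\mathtt{observe}(\phi)$: $[\phi]\cdot f$; $\mathtt{score}(E)$: $\sigma\mapsto[\sigma(E)\in(0,1]]\cdot\sigma(E)\cdot f(\sigma)$; - $C_1;C_2$: $\mathtt{wlp}[\![C_1]\!](\mathtt{wlp}[\![C_2]\!](f))$; $\mathtt{if}(\phi)\{C\}$: $[\phi]\cdot\mathtt{wlp}[\![C]\!](f)+[\neg\phi]\cdot f$; - $\mathtt{while}(\phi)\{C\}$: the greatest fixpoint of $X\mapsto[\neg\phi]\cdot f+[\phi]\cdot\mathtt{wlp}[\![C]\!](X)$ among the measurable functions $\Omega\to[0,1]$, ordered pointwise. **Entropy.** An entropy space is a measurable space $\mathbb S$ with a probability measure $\mu_{\mathbb S}$ and measurable maps $\pi_U:\mathbb S\to[0,1]$, $\pi_L,\pi_R:\mathbb S\to\mathbb S$ and a surjective $(::):\mathbb S\times\mathbb S\to\mathbb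 S$ such that $\pi_L(\theta_1::\theta_2)=\theta_1$, $\pi_R(\theta_1::\theta_2)=\theta_2$, and, for all measurable $f:[0,1]\to[0,\infty]$ and $g:\mathbb S\times\mathbb S\to[0,\infty]$, $\int f(\pi_U(\theta))\,\mu_{\mathbb S}(d\theta)=\int_{[0,1]}f(x)\,dx$ and $\int g(\pi_L(\theta),\pi_R(\theta))\,\mu_{\mathbb S}(d\theta)=\iint g(\theta_L,\theta_R)\,\mu_{\mathbb S}(d\theta_L)\,\mu_{\mathbb S}(d\theta_R)$. **Runs and scores.** A configuration $\langle\theta,C,K,\sigma,\theta_K,n,w\rangle$ consists of an entropy, the current statement, a continuation (a list of programs), a state or the failure state $\lightning$, the entropy of the continuation, a step count and a weight. The statement $\mathtt{skip}$ is the fully evaluated statement, also written $\downarrow$. A configuration whose state is a proper state $\sigma$ reduces in one step, which always increases $n$ by $1$, as follows (components not mentioned are unchanged). - $\mathtt{diverge}$ stays $\mathtt{diverge}$. - $x:=E$ becomes $\downarrow$ with state $\sigma[x\mapsto\sigma(E)]$. - $x:\approx U$ becomes $\downarrow$ with state $\sigma[x\mapsto\pi_U(\pi_L(\theta))]$ and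 entropy $\pi_R(\theta)$. - $\mathtt{observe}(\phi)$ becomes $\downarrow$ if $\sigma(\phi)=\mathtt{true}$; otherwise it becomes $\downarrow$ with empty continuation and state $\lightning$. - $\mathtt{score}(E)$, if $\sigma(E)\in(0,1]$, becomes $\downarrow$ with weight $w\cdot\sigma(E)$. - A sequence with first statement $C_1$ and remaining statements $C_2$ becomes $C_1$ with entropy $\pi_L(\theta)$, continuation $C_2::K$ and continuation entropy $\pi_R(\theta)::\theta_K$. - $\downarrow$ with continuation $C::K$ becomes $C$ with continuation $K$, entropy $\pi_L(\theta_K)$ and continuation entropy $\pi_R(\theta_K)$; $\downarrow$ with empty continuation stays as it is. - $\mathtt{if}(\phi)\{C\}$ becomes $C$ if $\sigma(\phi)=\mathtt{true}$, and $\downarrow$ otherwise. - $\mathtt{while}(\phi)\{C\}$ becomes $C;\mathtt{while}(\phi)\{C\}$ if $\sigma(\phi)=\mathtt{true}$, and $\downarrow$ otherwise. No other configuration reduces. Let $\mathbf{SC}_C^\sigma(\theta,n)$ be the weight $w$ of the configuration with step count $n$ reached from $\langle\theta,C,[\,],\sigma,\theta_K,0,1\rangle$, if there is one and its state is not $\lightning$,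 and $0$ otherwise (the choice of $\theta_K$ is irrelevant). The score of the run is $\mathbf{SC}_C^\sigma(\theta)=\inf_n\mathbf{SC}_C^\sigma(\theta,n)$, which is also the limit as $n\to\infty$. **Statement.** For every entropy space, every program $C$ and every state $\sigma\in\Omega$, the function $\theta\mapsto\mathbf{SC}_C^\sigma(\theta)$ is measurable and $$\mathtt{wlp}[\![C]\!](1)(\sigma)=\int\mathbf{SC}_C^{\sigma}(\theta)\,\mu_{\mathbb S}(d\theta).$$ -/

import Mathlib

open MeasureTheory
open scoped ENNReal NNReal

namespace PL

universe u v

/-! ## States -/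

/-- A program state: a finite set of variables together with a real value for each of them. -/
@[ext]
structure State (Var : Type u) where
  dom : Finset Var
  val : dom → ℝ

variable {Var : Type u}

namespace State

/-- The state `σ[x ↦ v]`. -/
def update [DecidableEq Var] (σ : State Var) (x : Var) (v : ℝ) : State Var where
  dom := insert x σ.dom
  val y := if h : y.1 = x then v else σ.val ⟨y.1, (Finset.mem_insert.1 y.2).resolve_left h⟩

open Classical in
/-- The metric on states: the Manhattan distance between states with the same domain,
and `∞` between states with different domains. -/
noncomputable def dist (σ τ : State Var) : ℝ≥0∞ :=
  if h : σ.dom = τ.dom then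
    ∑ x : σ.dom, ENNReal.ofReal |σ.val x - τ.val ⟨x.1, h ▸ x.2⟩|
  else ⊤

theorem dist_mk (s : Finset Var) (f g : s → ℝ) :
    dist ⟨s, f⟩ ⟨s, g⟩ = ∑ x : s, ENNReal.ofReal |f x - g x| := by
  simp [dist]

theorem dist_of_ne {σ τ : State Var} (h : σ.dom ≠ τ.dom) : dist σ τ = ⊤ := by
  simp [dist, h]

noncomputable instance : EMetricSpace (State Var) where
  edist := dist
  edist_self σ := by
    obtain ⟨s, f⟩ := σ
    rw [dist_mk]; simp
  edist_comm σ τ := by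
    by_cases h : σ.dom = τ.dom
    · obtain ⟨s, f⟩ := σ
      obtain ⟨t, g⟩ := τ
      obtain rfl : s = t := h
      rw [dist_mk, dist_mk]
      exact Finset.sum_congr rfl fun x _ => by rw [abs_sub_comm]
    · rw [dist_of_ne h, dist_of_ne (Ne.symm h)]
  edist_triangle σ τ ρ := by
    by_cases h : σ.dom = τ.dom
    · by_cases h' : τ.dom = ρ.dom
      · obtain ⟨s, f⟩ := σ
        obtain ⟨t, g⟩ := τ
        obtain ⟨r, k⟩ := ρ
        obtain rfl : s = t := h
        obtain rfl : s = r := h'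
        rw [dist_mk, dist_mk, dist_mk, ← Finset.sum_add_distrib]
        refine Finset.sum_le_sum fun x _ => ?_
        rw [← ENNReal.ofReal_add (abs_nonneg _) (abs_nonneg _)]
        exact ENNReal.ofReal_le_ofReal (abs_sub_le _ _ _)
      · rw [dist_of_ne h']; simp
    · rw [dist_of_ne h]; simp
  eq_of_edist_eq_zero {σ τ} h := by
    change dist _ _ = 0 at h
    by_cases hd : σ.dom = τ.dom
    · obtain ⟨s, f⟩ := σ
      obtain ⟨t, g⟩ := τ
      obtain rfl : s = t := hd
      rw [dist_mk, Finset.sum_eq_zero_iff] at h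
      congr 1
      funext x
      have := h x (Finset.mem_univ x)
      rw [ENNReal.ofReal_eq_zero] at this
      exact sub_eq_zero.1 (abs_nonpos_iff.1 this)
    · rw [dist_of_ne hd] at h; simp at h

/-- The Borel sigma-algebra of the metric. -/
noncomputable instance : MeasurableSpace (State Var) := borel _

instance : BorelSpace (State Var) := ⟨rfl⟩

end State

/-! ## Programs -/

/-- The syntax of arithmetic expressions and predicates is left open: it may be anything that
comes with total, measurable evaluation functions. -/
structure ExprLang (Var : Type u) where
  Expr : Type v
  Pred : Type v
  evalE : Expr → State Var → ℝ
  evalP : Pred → State Var → Bool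
  measurable_evalE : ∀ E, Measurable (evalE E)
  measurable_evalP : ∀ φ, Measurable (evalP φ)

/-- Programs. The statement `skip` is also the fully evaluated statement `↓` of the
operational semantics. -/
inductive Prog (L : ExprLang.{u, v} Var) : Type (max u v)
  | skip : Prog L
  | diverge : Prog L
  | assign (x : Var) (E : L.Expr) : Prog L
  | draw (x : Var) : Prog L
  | observe (φ : L.Pred) : Prog L
  | score (E : L.Expr) : Prog L
  | seq (C₁ C₂ : Prog L) : Prog L
  | ite (φ : L.Pred) (C : Prog L) : Prog L
  | while (φ : L.Pred) (C : Prog L) : Prog L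

variable {L : ExprLang.{u, v} Var}

/-- `splitSeq C₁ C₂` splits the sequence of statements `C₁; C₂` (sequential composition being
associative) into its first statement, which is not a sequence, and the sequence of the
remaining statements. -/
def Prog.splitSeq : Prog L → Prog L → Prog L × Prog L
  | .seq A B, D => Prog.splitSeq A (.seq B D)
  | C, D => (C, D)

/-! ## Weakest liberal preexpectation -/

/-- The greatest fixpoint of `Φ` among the measurable functions with values in `[0,1]`,
ordered pointwise (the least upper bound of all these fixpoints, which is the greatest of them
whenever there is a greatest one). -/
noncomputable def gfpMeas (Φ : (State Var → ℝ≥0∞) → State Var → ℝ≥0∞) : State Var → ℝ≥0∞ :=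
  sSup {X | Measurable X ∧ (∀ σ, X σ ≤ 1) ∧ Φ X = X}

/-- The weakest liberal preexpectation of `f`, for measurable `f` with values in `[0,1]`. -/
noncomputable def wlp [DecidableEq Var] : Prog L → (State Var → ℝ≥0∞) → State Var → ℝ≥0∞
  | .skip, f => f
  | .diverge, _ => fun _ => 1
  | .assign x E, f => fun σ => f (σ.update x (L.evalE E σ))
  | .draw x, f => fun σ => ∫⁻ v in Set.Icc (0 : ℝ) 1, f (σ.update x v)
  | .observe φ, f => fun σ => if L.evalP φ σ = true then f σ else 0
  | .score E, f => fun σ =>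
      if L.evalE E σ ∈ Set.Ioc (0 : ℝ) 1 then ENNReal.ofReal (L.evalE E σ) * f σ else 0
  | .seq C₁ C₂, f => wlp C₁ (wlp C₂ f)
  | .ite φ C, f => fun σ => if L.evalP φ σ = true then wlp C f σ else f σ
  | .while φ C, f => gfpMeas fun X σ => if L.evalP φ σ = true then wlp C X σ else f σ

/-! ## Entropy spaces -/

/-- An entropy space structure on a measurable space `S`. -/
structure EntropySpace (S : Type*) [MeasurableSpace S] where
  μ : Measure S
  μ_univ : μ Set.univ = 1
  πU : S → unitInterval
  πL : S → S
  πR : S → S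
  pair : S → S → S
  measurable_πU : Measurable πU
  measurable_πL : Measurable πL
  measurable_πR : Measurable πR
  measurable_pair : Measurable fun p : S × S => pair p.1 p.2
  πL_pair : ∀ θ₁ θ₂, πL (pair θ₁ θ₂) = θ₁
  πR_pair : ∀ θ₁ θ₂, πR (pair θ₁ θ₂) = θ₂
  pair_surjective : ∀ θ, ∃ θ₁ θ₂, pair θ₁ θ₂ = θ
  lintegral_πU : ∀ f : unitInterval → ℝ≥0∞, Measurable f →
    ∫⁻ θ, f (πU θ) ∂μ = ∫⁻ x, f x
  lintegral_πL_πR : ∀ g : S × S → ℝ≥0∞, Measurable g →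
    ∫⁻ θ, g (πL θ, πR θ) ∂μ = ∫⁻ θR, ∫⁻ θL, g (θL, θR) ∂μ ∂μ

/-! ## Operational semantics -/

/-- States extended with the failure state `↯` and the divergence state `↑`. -/
inductive ExtState (Var : Type u) : Type u
  | proper (σ : State Var)
  | fail
  | diverged

/-- A configuration `⟨θ, C, K, σ, θK, n, w⟩`. -/
structure Config (L : ExprLang.{u, v} Var) (S : Type*) where
  θ : S
  stmt : Prog L
  cont : List (Prog L)
  state : ExtState Var
  θK : S
  steps : ℕ
  weight : ℝ≥0

variable {S : Type*} [MeasurableSpace S]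

open ExtState in
/-- The reduction relation on configurations. The rules `pop` and `final` are those for the fully
evaluated statement `↓`, which is `skip`; the divergence state `↑` does not occur in the
configurations of a run. -/
inductive Step [DecidableEq Var] (𝔼 : EntropySpace S) : Config L S → Config L S → Prop
  | diverge {θ K σ θK n w} :
      Step 𝔼 ⟨θ, .diverge, K, proper σ, θK, n, w⟩ ⟨θ, .diverge, K, proper σ, θK, n + 1, w⟩
  | assign {θ x E K σ θK n w} :
      Step 𝔼 ⟨θ, .assign x E, K, proper σ, θK, n, w⟩
        ⟨θ, .skip, K, proper (σ.update x (L.evalE E σ)), θK, n + 1, w⟩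
  | draw {θ x K σ θK n w} :
      Step 𝔼 ⟨θ, .draw x, K, proper σ, θK, n, w⟩
        ⟨𝔼.πR θ, .skip, K, proper (σ.update x (𝔼.πU (𝔼.πL θ))), θK, n + 1, w⟩
  | conditionTrue {θ φ K σ θK n w} : L.evalP φ σ = true →
      Step 𝔼 ⟨θ, .observe φ, K, proper σ, θK, n, w⟩ ⟨θ, .skip, K, proper σ, θK, n + 1, w⟩
  | conditionFalse {θ φ K σ θK n w} : L.evalP φ σ = false →
      Step 𝔼 ⟨θ, .observe φ, K, proper σ, θK, n, w⟩ ⟨θ, .skip, [], fail, θK, n + 1, w⟩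
  | score {θ E K σ θK n w} : L.evalE E σ ∈ Set.Ioc (0 : ℝ) 1 →
      Step 𝔼 ⟨θ, .score E, K, proper σ, θK, n, w⟩
        ⟨θ, .skip, K, proper σ, θK, n + 1, w * (L.evalE E σ).toNNReal⟩
  | seq {θ C₁ C₂ K σ θK n w} :
      Step 𝔼 ⟨θ, .seq C₁ C₂, K, proper σ, θK, n, w⟩
        ⟨𝔼.πL θ, (C₁.splitSeq C₂).1, (C₁.splitSeq C₂).2 :: K, proper σ,
          𝔼.pair (𝔼.πR θ) θK, n + 1, w⟩
  | pop {θ C K σ θK n w} :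
      Step 𝔼 ⟨θ, .skip, C :: K, proper σ, θK, n, w⟩
        ⟨𝔼.πL θK, C, K, proper σ, 𝔼.πR θK, n + 1, w⟩
  | ifTrue {θ φ C K σ θK n w} : L.evalP φ σ = true →
      Step 𝔼 ⟨θ, .ite φ C, K, proper σ, θK, n, w⟩ ⟨θ, C, K, proper σ, θK, n + 1, w⟩
  | ifFalse {θ φ C K σ θK n w} : L.evalP φ σ = false →
      Step 𝔼 ⟨θ, .ite φ C, K, proper σ, θK, n, w⟩ ⟨θ, .skip, K, proper σ, θK, n + 1, w⟩
  | whileTrue {θ φ C K σ θK n w} : L.evalP φ σ = true →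
      Step 𝔼 ⟨θ, .while φ C, K, proper σ, θK, n, w⟩
        ⟨θ, .seq C (.while φ C), K, proper σ, θK, n + 1, w⟩
  | whileFalse {θ φ C K σ θK n w} : L.evalP φ σ = false →
      Step 𝔼 ⟨θ, .while φ C, K, proper σ, θK, n, w⟩ ⟨θ, .skip, K, proper σ, θK, n + 1, w⟩
  | final {θ σ θK n w} :
      Step 𝔼 ⟨θ, .skip, [], proper σ, θK, n, w⟩ ⟨θ, .skip, [], proper σ, θK, n + 1, w⟩

/-- The run of `C` from `σ` with entropy `θ` (and some initial continuation entropy, which is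
irrelevant) reaches after `n` steps a configuration of weight `w` whose state is not `↯`. -/
def Reaches [DecidableEq Var] (𝔼 : EntropySpace S) (C : Prog L) (σ : State Var) (θ : S) (n : ℕ)
    (w : ℝ≥0) : Prop :=
  ∃ (θK : S) (κ : Config L S),
    Relation.ReflTransGen (Step 𝔼) ⟨θ, C, [], .proper σ, θK, 0, 1⟩ κ ∧
      κ.steps = n ∧ κ.state ≠ .fail ∧ κ.weight = w

open Classical in
/-- The score after `n` steps: the weight reached, and `0` if there is none. -/
noncomputable def scoreAt [DecidableEq Var] (𝔼 : EntropySpace S) (C : Prog L) (σ : State Var)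
    (θ : S) (n : ℕ) : ℝ≥0 :=
  if h : ∃ w, Reaches 𝔼 C σ θ n w then h.choose else 0

/-- The score of the run of `C` from an extended state with entropy `θ`. -/
noncomputable def SC [DecidableEq Var] (𝔼 : EntropySpace S) (C : Prog L) :
    ExtState Var → S → ℝ≥0
  | .proper σ, θ => ⨅ n, scoreAt 𝔼 C σ θ n
  | .diverged, _ => 1
  | .fail, _ => 0

end PL

namespace PL

universe u v

variable {Var : Type u} {L : ExprLang.{u, v} Var}

/-! ## Measurability of updates -/

/-! Every reduction step multiplies the weight by a factor in `[0,1]`, so the score after `n` steps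
decreases in `n`, and monotone convergence makes the integral of the final score the infimum of the
integrals after `n` steps. `runScore` gives the score after `n` steps by recursion, and `meanScore`
averages it over the entropy and the continuation entropy, drawn independently. The entropy axioms
say that the two halves of a random entropy are independent and that pairing two independent
entropies gives a random one. Hence splitting, pushing, popping and drawing always leave fresh
entropy, and the mean scores obey one-step equations free of entropies.

Let `limScore` be the infimum of the mean scores. It dominates `wlp`: by induction on `n` each mean
score does, since `wlp` satisfies the same one-step equations, and for loops it suffices that `wlp`
is a fixpoint (`wlp_le_meanScore`). Conversely `limScore` is below `wlp` by structural induction: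
for a loop it is a post-fixpoint of the loop functional, hence below the greatest fixpoint
(`limScore_le_wlp`).

Measurable functions do not form a complete lattice, so Knaster-Tarski is not available. Instead
`wlp C` commutes with decreasing sequential infima (`wlp_cocontinuous`); the greatest fixpoint is
then the infimum of the iterates from `1`, which is measurable. -/

theorem State.edist_def (σ τ : State Var) : edist σ τ = State.dist σ τ := rfl

theorem State.dist_update_le [DecidableEq Var] (σ τ : State Var) (x : Var) (v w : ℝ) :
    edist (σ.update x v) (τ.update x w) ≤ edist σ τ + edist v w := by
  simp only [State.edist_def]
  by_cases h : σ.dom = τ.dom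
  · obtain ⟨s, f⟩ := σ
    obtain ⟨t, g⟩ := τ
    obtain rfl : s = t := h
    rw [State.dist_mk, State.update, State.update, State.dist_mk, edist_dist, Real.dist_eq]
    -- Extending the summand by zero to all variables makes sums over the two different domain
    -- subtypes comparable.
    let F : Var → ℝ≥0∞ := fun y =>
      if h : y ∈ s then ENNReal.ofReal |f ⟨y, h⟩ - g ⟨y, h⟩| else 0
    have hF : ∑ y : s, ENNReal.ofReal |f y - g y| = ∑ y ∈ s, F y := by
      rw [← Finset.sum_coe_sort s F]
      exact Finset.sum_congr rfl fun y _ => by simp [F]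
    let G : Var → ℝ≥0∞ := fun y => F y + if y = x then ENNReal.ofReal |v - w| else 0
    calc _ ≤ ∑ y : (insert x s : Finset Var), G y := by
          refine Finset.sum_le_sum fun y _ => ?_
          by_cases hy : y.1 = x
          · simp [G, hy]
          · have := (Finset.mem_insert.1 y.2).resolve_left hy
            simp [G, F, hy, this]
      _ = ∑ y ∈ insert x s, G y := Finset.sum_coe_sort (insert x s) G
      _ = _ := by
          rw [hF, Finset.sum_add_distrib]
          congr 1
          · refine (Finset.sum_subset (Finset.subset_insert x s) fun y _ hy => ?_).symm
            simp [F, hy]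
          · simp
  · rw [State.dist_of_ne h]; simp

/-- Joint continuity suffices: `ℝ` is second countable, so open sets of the product are measurable
for the product sigma-algebra. -/
theorem State.measurable_update [DecidableEq Var] (x : Var) :
    Measurable fun p : State Var × ℝ => p.1.update x p.2 := by
  have h : LipschitzWith 2 fun p : State Var × ℝ => p.1.update x p.2 := by
    intro p q
    refine (State.dist_update_le _ _ _ _ _).trans ?_
    rw [Prod.edist_eq, ENNReal.coe_ofNat, two_mul]
    exact add_le_add (le_max_left _ _) (le_max_right _ _)
  exact h.continuous.measurable

/-! ## Cocontinuity of the weakest liberal preexpectation -/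

/-- Measurable functions with values in `[0,1]`. -/
structure IsPreexp {α : Type*} [MeasurableSpace α] (f : α → ℝ≥0∞) : Prop where
  measurable : Measurable f
  le_one : ∀ a, f a ≤ 1

theorem IsPreexp.one {α : Type*} [MeasurableSpace α] : IsPreexp fun _ : α => (1 : ℝ≥0∞) :=
  ⟨measurable_const, fun _ => le_rfl⟩

theorem IsPreexp.iInf {α : Type*} [MeasurableSpace α] {F : ℕ → α → ℝ≥0∞}
    (h : ∀ n, IsPreexp (F n)) : IsPreexp (⨅ n, F n) := by
  have hF : ⨅ n, F n = fun a => ⨅ n, F n a := funext fun _ => iInf_apply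
  rw [hF]
  exact ⟨Measurable.iInf fun n => (h n).measurable, fun a => (iInf_le _ 0).trans ((h 0).le_one a)⟩

theorem IsPreexp.ite {f g : State Var → ℝ≥0∞} (hf : IsPreexp f) (hg : IsPreexp g) (φ : L.Pred) :
    IsPreexp fun σ => if L.evalP φ σ = true then f σ else g σ := by
  refine ⟨Measurable.ite (L.measurable_evalP φ (measurableSet_singleton true))
    hf.measurable hg.measurable, fun σ => ?_⟩
  split_ifs
  exacts [hf.le_one σ, hg.le_one σ]

/-- Transformers of preexpectations that commute with infima of decreasing sequences. -/
structure Cocontinuous {α : Type*} [MeasurableSpace α]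
    (T : (α → ℝ≥0∞) → α → ℝ≥0∞) : Prop where
  isPreexp : ∀ {f}, IsPreexp f → IsPreexp (T f)
  map_iInf : ∀ {F : ℕ → α → ℝ≥0∞}, (∀ n, IsPreexp (F n)) → Antitone F →
    T (⨅ n, F n) = ⨅ n, T (F n)

namespace Cocontinuous

variable {α : Type*} [MeasurableSpace α] {T : (α → ℝ≥0∞) → α → ℝ≥0∞}

theorem mono (hT : Cocontinuous T) {f g : α → ℝ≥0∞} (hf : IsPreexp f) (hg : IsPreexp g)
    (h : f ≤ g) : T f ≤ T g := by
  -- The decreasing sequence `g, f, f, …` has infimum `f`, so commuting with infima already forces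
  -- monotonicity.
  let F : ℕ → α → ℝ≥0∞ := fun n => if n = 0 then g else f
  have hF : ∀ n, IsPreexp (F n) := fun n => by by_cases hn : n = 0 <;> simp [F, hn, hf, hg]
  have hanti : Antitone F := by
    refine antitone_nat_of_succ_le fun n => ?_
    by_cases hn : n = 0 <;> simp [F, hn, h]
  have hinf : ⨅ n, F n = f := by
    refine le_antisymm ((iInf_le F 1).trans (by simp [F])) (le_iInf fun n => ?_)
    by_cases hn : n = 0 <;> simp [F, hn, h]
  have := hT.map_iInf hF hanti
  rw [hinf] at this
  rw [this]
  exact (iInf_le _ 0).trans (by simp [F])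

theorem isPreexp_iterate (hT : Cocontinuous T) (n : ℕ) :
    IsPreexp (T^[n] fun _ => 1) := by
  induction n with
  | zero => exact IsPreexp.one
  | succ n ih => rw [Function.iterate_succ_apply']; exact hT.isPreexp ih

theorem antitone_iterate (hT : Cocontinuous T) :
    Antitone fun n => T^[n] fun _ => 1 := by
  refine antitone_nat_of_succ_le fun n => ?_
  induction n with
  | zero => exact (hT.isPreexp_iterate 1).le_one
  | succ n ih =>
    simp only [Function.iterate_succ_apply' T (n + 1), Function.iterate_succ_apply' T n] at ih ⊢
    exact hT.mono (hT.isPreexp (hT.isPreexp_iterate n)) (hT.isPreexp_iterate n) ih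

theorem map_iInf_iterate (hT : Cocontinuous T) :
    T (⨅ n, T^[n] fun _ => 1) = ⨅ n, T^[n] fun _ => 1 := by
  rw [hT.map_iInf hT.isPreexp_iterate hT.antitone_iterate]
  simp_rw [← Function.iterate_succ_apply' T]
  exact hT.antitone_iterate.iInf_nat_add 1

theorem le_iInf_iterate (hT : Cocontinuous T) {X : α → ℝ≥0∞} (hX : IsPreexp X) (h : X ≤ T X) :
    X ≤ ⨅ n, T^[n] fun _ => 1 := by
  refine le_iInf fun n => ?_
  induction n with
  | zero => exact hX.le_one
  | succ n ih =>
    rw [Function.iterate_succ_apply']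
    exact h.trans (hT.mono hX (hT.isPreexp_iterate n) ih)

end Cocontinuous

/-- The iterates are countably many measurable functions, so their infimum is itself one of the
competing fixpoints, and it bounds all the others. -/
theorem gfpMeas_eq {T : (State Var → ℝ≥0∞) → State Var → ℝ≥0∞} (hT : Cocontinuous T) :
    gfpMeas T = ⨅ n, T^[n] fun _ => 1 := by
  have hp := IsPreexp.iInf hT.isPreexp_iterate
  refine le_antisymm (sSup_le ?_) (le_sSup ⟨hp.measurable, hp.le_one, hT.map_iInf_iterate⟩)
  rintro X ⟨hm, h1, hX⟩
  exact hT.le_iInf_iterate ⟨hm, h1⟩ hX.ge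

theorem Cocontinuous.ite {T U : (State Var → ℝ≥0∞) → State Var → ℝ≥0∞} (hT : Cocontinuous T)
    (hU : Cocontinuous U) (φ : L.Pred) :
    Cocontinuous fun X σ => if L.evalP φ σ = true then T X σ else U X σ where
  isPreexp h := (hT.isPreexp h).ite (hU.isPreexp h) φ
  map_iInf hF ha := by
    rw [hT.map_iInf hF ha, hU.map_iInf hF ha]
    funext σ
    simp only [iInf_apply]
    split_ifs <;> rfl

theorem Cocontinuous.const {f : State Var → ℝ≥0∞} (hf : IsPreexp f) :
    Cocontinuous fun _ : State Var → ℝ≥0∞ => f :=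
  ⟨fun _ => hf, fun _ _ => by simp⟩

theorem Cocontinuous.id : Cocontinuous fun f : State Var → ℝ≥0∞ => f :=
  ⟨fun h => h, fun _ _ => rfl⟩

/-- Dependence of a loop on its postexpectation. The infimum over iterates and the infimum over the
sequence can be exchanged, so it is enough to treat each finite iterate, by induction. -/
theorem iInf_iterate_cocontinuous {T : (State Var → ℝ≥0∞) → State Var → ℝ≥0∞}
    (hT : Cocontinuous T) (φ : L.Pred) :
    Cocontinuous fun f => ⨅ n, (fun X σ => if L.evalP φ σ = true then T X σ else f σ)^[n]
      fun _ => 1 := by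
  have hco {f : State Var → ℝ≥0∞} (hf : IsPreexp f) := hT.ite (Cocontinuous.const hf) φ
  refine ⟨fun hf => IsPreexp.iInf (hco hf).isPreexp_iterate, fun {F} hF ha => ?_⟩
  have hanti : ∀ k, Antitone fun n =>
      (fun X σ => if L.evalP φ σ = true then T X σ else F n σ)^[k] fun _ => 1 := by
    intro k
    induction k with
    | zero => exact antitone_const
    | succ k ih =>
      intro m n hmn
      simp only [Function.iterate_succ_apply']
      intro σ
      dsimp only
      split_ifs
      · exact hT.mono ((hco (hF n)).isPreexp_iterate k) ((hco (hF m)).isPreexp_iterate k)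
          (ih hmn) σ
      · exact ha hmn σ
  rw [iInf_comm]
  refine iInf_congr fun k => ?_
  induction k with
  | zero => simp
  | succ k ih =>
    simp only [Function.iterate_succ_apply']
    rw [ih, hT.map_iInf (fun n => (hco (hF n)).isPreexp_iterate k) (hanti k)]
    funext σ
    simp only [iInf_apply]
    split_ifs <;> rfl

variable [DecidableEq Var]

theorem wlp_cocontinuous : ∀ C : Prog L, Cocontinuous (wlp C)
  | .skip => Cocontinuous.id
  | .diverge => Cocontinuous.const IsPreexp.one
  | .assign x E => by
      refine ⟨fun h => ⟨?_, fun σ => h.le_one _⟩, fun _ _ => ?_⟩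
      · exact h.measurable.comp ((State.measurable_update x).comp
          (measurable_id.prodMk (L.measurable_evalE E)))
      · funext σ; simp only [wlp, iInf_apply]
  | .draw x => by
      refine ⟨fun {f} h => ⟨?_, fun σ => ?_⟩, fun {F} hF ha => ?_⟩
      · have : Measurable (Function.uncurry fun σ v => f (State.update σ x v)) :=
          h.measurable.comp (State.measurable_update x)
        exact this.lintegral_prod_right
      · calc _ ≤ ∫⁻ v in Set.Icc (0 : ℝ) 1, 1 := lintegral_mono fun v => h.le_one _
          _ = 1 := by simp
      · funext σ
        simp only [wlp, iInf_apply]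
        -- Monotone convergence for a decreasing sequence; it needs the first integral to be finite.
        refine lintegral_iInf (fun n => ?_) (fun m n hmn v => ha hmn _) ?_
        · exact (hF n).measurable.comp ((State.measurable_update x).comp measurable_prodMk_left)
        · refine ne_top_of_le_ne_top ENNReal.one_ne_top ?_
          calc _ ≤ ∫⁻ v in Set.Icc (0 : ℝ) 1, 1 := lintegral_mono fun v => (hF 0).le_one _
            _ = 1 := by simp
  | .observe φ => Cocontinuous.id.ite (Cocontinuous.const ⟨measurable_const, by simp⟩) φ
  | .score E => by
      refine ⟨fun {f} h => ⟨?_, fun σ => ?_⟩, fun {F} hF ha => ?_⟩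
      · exact Measurable.ite (L.measurable_evalE E measurableSet_Ioc)
          ((L.measurable_evalE E).ennreal_ofReal.mul h.measurable) measurable_const
      · simp only [wlp]
        split_ifs with hE
        · exact mul_le_one' (ENNReal.ofReal_le_one.2 hE.2) (h.le_one _)
        · exact zero_le_one
      · funext σ
        simp only [wlp, iInf_apply]
        split_ifs with hE
        · exact ENNReal.mul_iInf_of_ne (ENNReal.ofReal_pos.2 hE.1).ne' ENNReal.ofReal_ne_top
        · simp
  | .seq C₁ C₂ => by
      have h₁ := wlp_cocontinuous C₁
      have h₂ := wlp_cocontinuous C₂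
      refine ⟨fun h => h₁.isPreexp (h₂.isPreexp h), fun {F} hF ha => ?_⟩
      simp only [wlp]
      rw [h₂.map_iInf hF ha]
      exact h₁.map_iInf (fun n => h₂.isPreexp (hF n))
        fun m n hmn => h₂.mono (hF n) (hF m) (ha hmn)
  | .ite φ C => (wlp_cocontinuous C).ite Cocontinuous.id φ
  | .while φ C => by
      have hC := wlp_cocontinuous C
      have h := iInf_iterate_cocontinuous hC φ
      have key {f : State Var → ℝ≥0∞} (hf : IsPreexp f) :
          wlp (.while φ C) f = ⨅ n, (fun X σ => if L.evalP φ σ = true then wlp C X σ else f σ)^[n]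
            fun _ => 1 := by
        simp only [wlp]
        exact gfpMeas_eq (hC.ite (Cocontinuous.const hf) φ)
      refine ⟨fun hf => key hf ▸ h.isPreexp hf, fun {F} hF ha => ?_⟩
      rw [key (IsPreexp.iInf hF), h.map_iInf hF ha]
      exact iInf_congr fun n => (key (hF n)).symm

theorem wlp_while (φ : L.Pred) (C : Prog L) {f : State Var → ℝ≥0∞} (hf : IsPreexp f) :
    wlp (.while φ C) f =
      fun σ => if L.evalP φ σ = true then wlp C (wlp (.while φ C) f) σ else f σ := by
  have hT := (wlp_cocontinuous C).ite (Cocontinuous.const hf) φ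
  have h : wlp (.while φ C) f = _ := gfpMeas_eq hT
  have h' := hT.map_iInf_iterate
  rw [← h] at h'
  exact h'.symm

theorem le_wlp_while (φ : L.Pred) (C : Prog L) {f X : State Var → ℝ≥0∞} (hf : IsPreexp f)
    (hX : IsPreexp X) (h : X ≤ fun σ => if L.evalP φ σ = true then wlp C X σ else f σ) :
    X ≤ wlp (.while φ C) f := by
  have hT := (wlp_cocontinuous C).ite (Cocontinuous.const hf) φ
  exact (hT.le_iInf_iterate hX h).trans (gfpMeas_eq hT).ge

variable {S : Type*} [MeasurableSpace S]

/-! ## The score after a number of steps as a recursive function -/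

open Classical in
/-- The factor by which the next `n` steps change the weight of the configuration with statement
`C`, continuation `K`, entropy `θ`, state `σ` and continuation entropy `θK`; it is `0` if the
run fails or gets stuck. -/
noncomputable def runScore (𝔼 : EntropySpace S) :
    ℕ → Prog L → List (Prog L) → S → State Var → S → ℝ≥0
  | 0, _, _, _, _, _ => 1
  | n + 1, .skip, [], θ, σ, θK => runScore 𝔼 n .skip [] θ σ θK
  | n + 1, .skip, C :: K, _, σ, θK => runScore 𝔼 n C K (𝔼.πL θK) σ (𝔼.πR θK)
  | n + 1, .diverge, K, θ, σ, θK => runScore 𝔼 n .diverge K θ σ θK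
  | n + 1, .assign x E, K, θ, σ, θK => runScore 𝔼 n .skip K θ (σ.update x (L.evalE E σ)) θK
  | n + 1, .draw x, K, θ, σ, θK =>
      runScore 𝔼 n .skip K (𝔼.πR θ) (σ.update x (𝔼.πU (𝔼.πL θ))) θK
  | n + 1, .observe φ, K, θ, σ, θK =>
      if L.evalP φ σ = true then runScore 𝔼 n .skip K θ σ θK else 0
  | n + 1, .score E, K, θ, σ, θK =>
      if L.evalE E σ ∈ Set.Ioc (0 : ℝ) 1 then
        (L.evalE E σ).toNNReal * runScore 𝔼 n .skip K θ σ θK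
      else 0
  | n + 1, .seq C₁ C₂, K, θ, σ, θK =>
      runScore 𝔼 n (C₁.splitSeq C₂).1 ((C₁.splitSeq C₂).2 :: K) (𝔼.πL θ) σ (𝔼.pair (𝔼.πR θ) θK)
  | n + 1, .ite φ C, K, θ, σ, θK =>
      if L.evalP φ σ = true then runScore 𝔼 n C K θ σ θK else runScore 𝔼 n .skip K θ σ θK
  | n + 1, .while φ C, K, θ, σ, θK =>
      if L.evalP φ σ = true then runScore 𝔼 n (.seq C (.while φ C)) K θ σ θK
      else runScore 𝔼 n .skip K θ σ θK

theorem Step.steps_eq {𝔼 : EntropySpace S} {κ κ' : Config L S} (h : Step 𝔼 κ κ') :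
    κ'.steps = κ.steps + 1 := by
  cases h <;> rfl

theorem Step.steps_le {𝔼 : EntropySpace S} {κ κ' : Config L S}
    (h : Relation.ReflTransGen (Step 𝔼) κ κ') : κ.steps ≤ κ'.steps := by
  induction h with
  | refl => exact le_rfl
  | tail _ h ih => have := h.steps_eq; omega

theorem weight_eq_of_run (𝔼 : EntropySpace S) (n : ℕ) (θ : S) (C : Prog L) (K : List (Prog L))
    (σ : State Var) (θK : S) (m : ℕ) (w : ℝ≥0) (κ : Config L S)
    (h : Relation.ReflTransGen (Step 𝔼) ⟨θ, C, K, .proper σ, θK, m, w⟩ κ)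
    (hn : κ.steps = m + n) (hf : κ.state ≠ .fail) :
    κ.weight = w * runScore 𝔼 n C K θ σ θK := by
  induction n generalizing θ C K σ θK m w with
  | zero =>
    rcases h.cases_head with rfl | ⟨κ₁, h₁, h₂⟩
    · simp [runScore]
    · have := h₁.steps_eq
      have := Step.steps_le h₂
      simp only at *
      omega
  | succ n ih =>
    rcases h.cases_head with rfl | ⟨κ₁, h₁, h₂⟩
    · simp only at hn; omega
    · cases h₁
      case conditionFalse =>
        -- A failed configuration has no successor, so the run would have to end in failure, which
        -- `hf` excludes.
        rcases h₂.cases_head with rfl | ⟨κ₂, h₃, -⟩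
        · exact absurd rfl hf
        · cases h₃
      all_goals
        have := ih _ _ _ _ _ _ _ h₂ (by omega)
        rw [this]
        simp [runScore, mul_assoc, *]

/-- Covers the default value `0` of `scoreAt`: if no configuration is reached, `runScore` must
vanish as well. -/
theorem exists_run (𝔼 : EntropySpace S) (n : ℕ) (θ : S) (C : Prog L) (K : List (Prog L))
    (σ : State Var) (θK : S) (m : ℕ) (w : ℝ≥0) (h : runScore 𝔼 n C K θ σ θK ≠ 0) :
    ∃ κ : Config L S, Relation.ReflTransGen (Step 𝔼) ⟨θ, C, K, .proper σ, θK, m, w⟩ κ ∧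
      κ.steps = m + n ∧ κ.state ≠ .fail := by
  induction n generalizing θ C K σ θK m w with
  | zero => exact ⟨_, .refl, rfl, by simp⟩
  | succ n ih =>
    have key {θ' C' K' σ' θK' w'} (hs : Step 𝔼 ⟨θ, C, K, .proper σ, θK, m, w⟩
        ⟨θ', C', K', .proper σ', θK', m + 1, w'⟩) (h' : runScore 𝔼 n C' K' θ' σ' θK' ≠ 0) :
        ∃ κ : Config L S, Relation.ReflTransGen (Step 𝔼) ⟨θ, C, K, .proper σ, θK, m, w⟩ κ ∧
          κ.steps = m + (n + 1) ∧ κ.state ≠ .fail := by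
      obtain ⟨κ, h₁, h₂, h₃⟩ := ih _ _ _ _ _ (m + 1) w' h'
      exact ⟨κ, h₁.head hs, by omega, h₃⟩
    cases C with
    | skip =>
      cases K with
      | nil => exact key .final h
      | cons C K => exact key .pop h
    | diverge => exact key .diverge h
    | assign x E => exact key .assign h
    | draw x => exact key .draw h
    | observe φ =>
      simp only [runScore] at h
      split_ifs at h with hφ
      · exact key (.conditionTrue hφ) h
      · exact absurd rfl h
    | score E =>
      simp only [runScore] at h
      split_ifs at h with hE
      · exact key (.score hE) (right_ne_zero_of_mul h)
      · exact absurd rfl h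
    | seq C₁ C₂ => exact key .seq h
    | ite φ C =>
      simp only [runScore] at h
      split_ifs at h with hφ
      · exact key (.ifTrue hφ) h
      · exact key (.ifFalse (Bool.eq_false_iff.2 hφ)) h
    | _ =>
      rename_i φ C
      simp only [runScore] at h
      split_ifs at h with hφ
      · exact key (.whileTrue hφ) h
      · exact key (.whileFalse (Bool.eq_false_iff.2 hφ)) h

/-- Two entropies that provide the same entropies for the first `n` statements of a
continuation. -/
def EntropySpace.Agree (𝔼 : EntropySpace S) : ℕ → S → S → Prop
  | 0, _, _ => True
  | n + 1, θ, θ' => 𝔼.πL θ = 𝔼.πL θ' ∧ 𝔼.Agree n (𝔼.πR θ) (𝔼.πR θ')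

/-- Only one entropy per pending statement is ever read from the continuation entropy; a sequence
pushes one of each. For an empty continuation the hypothesis is vacuous, which makes the initial
continuation entropy irrelevant. -/
theorem runScore_congr (𝔼 : EntropySpace S) (n : ℕ) (C : Prog L) (K : List (Prog L)) (θ : S)
    (σ : State Var) {θK θK' : S} (h : 𝔼.Agree K.length θK θK') :
    runScore 𝔼 n C K θ σ θK = runScore 𝔼 n C K θ σ θK' := by
  induction n generalizing C K θ σ θK θK' with
  | zero => rfl
  | succ n ih =>
    cases C with
    | skip =>
      cases K with
      | nil => exact ih _ _ _ _ h
      | cons C K =>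
        simp only [runScore]
        rw [h.1]
        exact ih _ _ _ _ h.2
    | seq C₁ C₂ =>
      refine ih _ _ _ _ ?_
      simpa [EntropySpace.Agree, 𝔼.πL_pair, 𝔼.πR_pair] using h
    | _ => simp only [runScore, ih _ _ _ _ h]

theorem scoreAt_eq (𝔼 : EntropySpace S) (C : Prog L) (σ : State Var) (θ θK : S) (n : ℕ) :
    scoreAt 𝔼 C σ θ n = runScore 𝔼 n C [] θ σ θK := by
  have key {w} (h : Reaches 𝔼 C σ θ n w) : w = runScore 𝔼 n C [] θ σ θK := by
    obtain ⟨θK', κ, h₁, h₂, h₃, rfl⟩ := h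
    rw [weight_eq_of_run 𝔼 n _ _ _ _ _ _ _ κ h₁ (by omega) h₃, one_mul]
    exact runScore_congr 𝔼 n C [] θ σ trivial
  unfold scoreAt
  split_ifs with h
  · exact key h.choose_spec
  · by_contra h0
    obtain ⟨κ, h₁, h₂, h₃⟩ := exists_run 𝔼 n θ C [] σ θK 0 1 (Ne.symm h0)
    exact h ⟨_, θK, κ, h₁, by omega, h₃, rfl⟩

theorem runScore_succ_le (𝔼 : EntropySpace S) (n : ℕ) (C : Prog L) (K : List (Prog L)) (θ : S)
    (σ : State Var) (θK : S) : runScore 𝔼 (n + 1) C K θ σ θK ≤ runScore 𝔼 n C K θ σ θK := by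
  induction n generalizing C K θ σ θK with
  | zero =>
    cases C with
    | skip => cases K <;> simp [runScore]
    | score E =>
      simp only [runScore]
      split_ifs with h
      · simpa using h.2
      · exact zero_le_one
    | _ =>
      simp only [runScore]
      first | exact le_rfl | (split_ifs <;> simp)
  | succ n ih =>
    cases C with
    | skip => cases K <;> exact ih _ _ _ _ _
    | score E =>
      rw [runScore, runScore]
      split_ifs
      · exact mul_le_mul_right (ih _ _ _ _ _) _
      · exact le_rfl
    | observe φ =>
      rw [runScore, runScore]
      split_ifs
      exacts [ih _ _ _ _ _, le_rfl]
    | ite φ C =>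
      rw [runScore, runScore]
      split_ifs <;> exact ih _ _ _ _ _
    | diverge | assign | draw | seq => exact ih _ _ _ _ _
    | _ =>
      change ite _ _ _ ≤ ite _ _ _
      split_ifs <;> exact ih _ _ _ _ _

theorem runScore_antitone (𝔼 : EntropySpace S) (C : Prog L) (K : List (Prog L)) (θ : S)
    (σ : State Var) (θK : S) : Antitone fun n => runScore 𝔼 n C K θ σ θK :=
  antitone_nat_of_succ_le fun n => runScore_succ_le 𝔼 n C K θ σ θK

theorem runScore_le_one (𝔼 : EntropySpace S) (n : ℕ) (C : Prog L) (K : List (Prog L)) (θ : S)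
    (σ : State Var) (θK : S) : runScore 𝔼 n C K θ σ θK ≤ 1 :=
  runScore_antitone 𝔼 C K θ σ θK n.zero_le

theorem measurable_runScore (𝔼 : EntropySpace S) (n : ℕ) (C : Prog L) (K : List (Prog L)) :
    Measurable fun p : S × State Var × S => runScore 𝔼 n C K p.1 p.2.1 p.2.2 := by
  have hσ : Measurable fun p : S × State Var × S => p.2.1 := by fun_prop
  have hP (φ : L.Pred) : MeasurableSet {p : S × State Var × S | L.evalP φ p.2.1 = true} :=
    ((L.measurable_evalP φ).comp hσ) (measurableSet_singleton true)
  have hL := 𝔼.measurable_πL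
  have hR := 𝔼.measurable_πR
  have hpair := 𝔼.measurable_pair
  induction n generalizing C K with
  | zero => exact measurable_const
  | succ n ih =>
    cases C with
    | skip =>
      cases K with
      | nil => exact ih _ _
      | cons C K =>
        exact (ih C K).comp (g := fun p => runScore 𝔼 n C K p.1 p.2.1 p.2.2)
          (f := fun p : S × State Var × S => (𝔼.πL p.2.2, p.2.1, 𝔼.πR p.2.2)) (by fun_prop)
    | diverge => exact ih _ _
    | assign x E =>
      have hE : Measurable fun p : S × State Var × S => p.2.1.update x (L.evalE E p.2.1) :=
        (State.measurable_update x).comp (hσ.prodMk ((L.measurable_evalE E).comp hσ))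
      exact (ih .skip K).comp (g := fun p => runScore 𝔼 n .skip K p.1 p.2.1 p.2.2)
        (measurable_fst.prodMk (hE.prodMk (measurable_snd.comp measurable_snd)))
    | draw x =>
      have hU : Measurable fun p : S × State Var × S =>
          p.2.1.update x (𝔼.πU (𝔼.πL p.1) : ℝ) :=
        (State.measurable_update x).comp (hσ.prodMk
          (measurable_subtype_coe.comp (𝔼.measurable_πU.comp (hL.comp measurable_fst))))
      exact (ih .skip K).comp (g := fun p => runScore 𝔼 n .skip K p.1 p.2.1 p.2.2)
        ((hR.comp measurable_fst).prodMk (hU.prodMk (measurable_snd.comp measurable_snd)))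
    | observe φ => exact Measurable.ite (hP φ) (ih _ _) measurable_const
    | score E =>
      have hE := (L.measurable_evalE E).comp hσ
      exact Measurable.ite (hE measurableSet_Ioc) (hE.real_toNNReal.mul (ih _ _)) measurable_const
    | seq C₁ C₂ =>
      exact (ih (C₁.splitSeq C₂).1 ((C₁.splitSeq C₂).2 :: K)).comp
        (f := fun p : S × State Var × S => (𝔼.πL p.1, p.2.1, 𝔼.pair (𝔼.πR p.1) p.2.2))
        ((hL.comp measurable_fst).prodMk (hσ.prodMk (hpair.comp
          ((hR.comp measurable_fst).prodMk (measurable_snd.comp measurable_snd)))))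
    | ite φ C => exact Measurable.ite (hP φ) (ih _ _) (ih _ _)
    | _ => exact Measurable.ite (hP _) (ih _ _) (ih _ _)

/-! ## Mean scores -/

theorem EntropySpace.isProbabilityMeasure (𝔼 : EntropySpace S) : IsProbabilityMeasure 𝔼.μ :=
  ⟨𝔼.μ_univ⟩

/-- Surjectivity of pairing makes every entropy the pair of its two halves, so the independence
axiom can be read backwards. -/
theorem EntropySpace.lintegral_pair (𝔼 : EntropySpace S) {f : S → ℝ≥0∞} (hf : Measurable f) :
    ∫⁻ θ₂, ∫⁻ θ₁, f (𝔼.pair θ₁ θ₂) ∂𝔼.μ ∂𝔼.μ = ∫⁻ θ, f θ ∂𝔼.μ := by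
  rw [← 𝔼.lintegral_πL_πR (fun p => f (𝔼.pair p.1 p.2)) (hf.comp 𝔼.measurable_pair)]
  refine lintegral_congr fun θ => ?_
  obtain ⟨θ₁, θ₂, rfl⟩ := 𝔼.pair_surjective θ
  simp only [𝔼.πL_pair, 𝔼.πR_pair]

/-- The expectation of the score after `n` steps over the entropy and the continuation entropy. -/
noncomputable def meanScore (𝔼 : EntropySpace S) (n : ℕ) (C : Prog L) (K : List (Prog L))
    (σ : State Var) : ℝ≥0∞ :=
  ∫⁻ θK, ∫⁻ θ, (runScore 𝔼 n C K θ σ θK : ℝ≥0∞) ∂𝔼.μ ∂𝔼.μ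

section

variable (𝔼 : EntropySpace S) (n : ℕ) (K : List (Prog L)) (σ : State Var)

theorem measurable_coe_runScore (C : Prog L) {α : Type*} [MeasurableSpace α]
    {f : α → S} {g : α → State Var} {h : α → S} (hf : Measurable f) (hg : Measurable g)
    (hh : Measurable h) :
    Measurable fun a => (runScore 𝔼 n C K (f a) (g a) (h a) : ℝ≥0∞) :=
  ((measurable_runScore 𝔼 n C K).comp (hf.prodMk (hg.prodMk hh))).coe_nnreal_ennreal

theorem meanScore_le_one (C : Prog L) : meanScore 𝔼 n C K σ ≤ 1 := by
  have := 𝔼.isProbabilityMeasure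
  calc meanScore 𝔼 n C K σ ≤ ∫⁻ _, ∫⁻ _, 1 ∂𝔼.μ ∂𝔼.μ :=
        lintegral_mono fun _ => lintegral_mono fun _ =>
          ENNReal.coe_le_one_iff.2 (runScore_le_one 𝔼 n C K _ σ _)
    _ = 1 := by simp

theorem isPreexp_meanScore (C : Prog L) : IsPreexp (meanScore 𝔼 n C K) := by
  have := 𝔼.isProbabilityMeasure
  refine ⟨?_, fun σ => meanScore_le_one 𝔼 n K σ C⟩
  have h : Measurable fun p : (State Var × S) × S =>
      (runScore 𝔼 n C K p.2 p.1.1 p.1.2 : ℝ≥0∞) :=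
    measurable_coe_runScore 𝔼 n K C (by fun_prop) (by fun_prop) (by fun_prop)
  exact h.lintegral_prod_right'.lintegral_prod_right'

theorem meanScore_antitone (C : Prog L) : Antitone fun n => meanScore 𝔼 n C K :=
  fun _ _ h σ => lintegral_mono fun _ => lintegral_mono fun _ =>
    ENNReal.coe_le_coe.2 (runScore_antitone 𝔼 C K _ σ _ h)

theorem meanScore_zero (C : Prog L) : meanScore 𝔼 0 C K σ = 1 := by
  have := 𝔼.isProbabilityMeasure
  simp [meanScore, runScore]

theorem meanScore_pop (C : Prog L) :
    meanScore 𝔼 (n + 1) .skip (C :: K) σ = meanScore 𝔼 n C K σ := by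
  have := 𝔼.isProbabilityMeasure
  simp only [meanScore, runScore, lintegral_const, measure_univ, mul_one]
  exact 𝔼.lintegral_πL_πR (fun p => (runScore 𝔼 n C K p.1 σ p.2 : ℝ≥0∞))
    (measurable_coe_runScore 𝔼 n K C measurable_fst measurable_const measurable_snd)

/-- The drawn value comes from the left half of the entropy and is uniform, and the right half is
independent of it. Tonelli then moves the uniform integral outside. -/
theorem meanScore_draw (x : Var) :
    meanScore 𝔼 (n + 1) (.draw x) K σ =
      ∫⁻ v in Set.Icc (0 : ℝ) 1, meanScore 𝔼 n .skip K (σ.update x v) := by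
  have := 𝔼.isProbabilityMeasure
  have hup : Measurable fun u : unitInterval => σ.update x u :=
    (State.measurable_update x).comp (measurable_const.prodMk measurable_subtype_coe)
  have h₁ (θK : S) : ∫⁻ θ, (runScore 𝔼 (n + 1) (.draw x) K θ σ θK : ℝ≥0∞) ∂𝔼.μ =
      ∫⁻ θ, (∫⁻ u : unitInterval, (runScore 𝔼 n .skip K θ (σ.update x u) θK : ℝ≥0∞)) ∂𝔼.μ := by
    simp only [runScore]
    rw [𝔼.lintegral_πL_πR
      (fun p => (runScore 𝔼 n .skip K p.2 (σ.update x (𝔼.πU p.1)) θK : ℝ≥0∞))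
      (measurable_coe_runScore 𝔼 n K .skip measurable_snd
        (hup.comp (𝔼.measurable_πU.comp measurable_fst)) measurable_const)]
    refine lintegral_congr fun θ => ?_
    exact 𝔼.lintegral_πU (fun u => (runScore 𝔼 n .skip K θ (σ.update x u) θK : ℝ≥0∞))
      (measurable_coe_runScore 𝔼 n K .skip measurable_const hup measurable_const)
  have h₂ (θK : S) :
      ∫⁻ θ, (∫⁻ u : unitInterval, (runScore 𝔼 n .skip K θ (σ.update x u) θK : ℝ≥0∞)) ∂𝔼.μ =
      ∫⁻ u : unitInterval, ∫⁻ θ, (runScore 𝔼 n .skip K θ (σ.update x u) θK : ℝ≥0∞) ∂𝔼.μ :=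
    lintegral_lintegral_swap (measurable_coe_runScore 𝔼 n K .skip measurable_fst
      (hup.comp measurable_snd) measurable_const).aemeasurable
  rw [← lintegral_subtype_comap measurableSet_Icc]
  simp only [meanScore]
  simp_rw [h₁, h₂]
  have h₃ : Measurable fun p : (S × unitInterval) × S =>
      (runScore 𝔼 n .skip K p.2 (σ.update x p.1.2) p.1.1 : ℝ≥0∞) :=
    measurable_coe_runScore 𝔼 n K .skip measurable_snd
      (hup.comp (measurable_snd.comp measurable_fst)) (measurable_fst.comp measurable_fst)
  exact lintegral_lintegral_swap h₃.lintegral_prod_right'.aemeasurable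

theorem meanScore_seq (C₁ C₂ : Prog L) :
    meanScore 𝔼 (n + 1) (.seq C₁ C₂) K σ =
      meanScore 𝔼 n (C₁.splitSeq C₂).1 ((C₁.splitSeq C₂).2 :: K) σ := by
  have := 𝔼.isProbabilityMeasure
  simp only [meanScore, runScore]
  generalize (C₁.splitSeq C₂).1 = C
  generalize (C₁.splitSeq C₂).2 :: K = K
  have h : Measurable fun p : S × S => (runScore 𝔼 n C K p.2 σ p.1 : ℝ≥0∞) :=
    measurable_coe_runScore 𝔼 n K C measurable_snd measurable_const measurable_fst
  -- Only the right-hand side changes: its continuation entropy becomes a pair whose first component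
  -- is matched with `πR θ`.
  rw [← 𝔼.lintegral_pair h.lintegral_prod_right']
  refine lintegral_congr fun θK => ?_
  exact 𝔼.lintegral_πL_πR (fun p => (runScore 𝔼 n C K p.1 σ (𝔼.pair p.2 θK) : ℝ≥0∞))
    (measurable_coe_runScore 𝔼 n K C measurable_fst measurable_const
      (𝔼.measurable_pair.comp (measurable_snd.prodMk measurable_const)))

theorem meanScore_final : meanScore 𝔼 n (.skip : Prog L) [] σ = 1 := by
  induction n with
  | zero => exact meanScore_zero 𝔼 [] σ .skip
  | succ n ih => exact ih

theorem meanScore_diverge : meanScore 𝔼 n .diverge K σ = 1 := by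
  induction n with
  | zero => exact meanScore_zero 𝔼 K σ .diverge
  | succ n ih => exact ih

theorem meanScore_assign (x : Var) (E : L.Expr) :
    meanScore 𝔼 (n + 1) (.assign x E) K σ =
      meanScore 𝔼 n .skip K (σ.update x (L.evalE E σ)) := rfl

theorem meanScore_observe (φ : L.Pred) :
    meanScore 𝔼 (n + 1) (.observe φ) K σ =
      if L.evalP φ σ = true then meanScore 𝔼 n .skip K σ else 0 := by
  simp only [meanScore, runScore]
  split_ifs <;> simp

theorem meanScore_score (E : L.Expr) :
    meanScore 𝔼 (n + 1) (.score E) K σ =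
      if L.evalE E σ ∈ Set.Ioc (0 : ℝ) 1 then
        ENNReal.ofReal (L.evalE E σ) * meanScore 𝔼 n .skip K σ
      else 0 := by
  simp only [meanScore, runScore]
  split_ifs
  · simp only [ENNReal.coe_mul]
    simp_rw [lintegral_const_mul' _ _ ENNReal.coe_ne_top]
    rfl
  · simp

theorem meanScore_ite (φ : L.Pred) (C : Prog L) :
    meanScore 𝔼 (n + 1) (.ite φ C) K σ =
      if L.evalP φ σ = true then meanScore 𝔼 n C K σ else meanScore 𝔼 n .skip K σ := by
  simp only [meanScore, runScore]
  split_ifs <;> rfl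

theorem meanScore_while (φ : L.Pred) (C : Prog L) :
    meanScore 𝔼 (n + 1) (.while φ C) K σ =
      if L.evalP φ σ = true then meanScore 𝔼 n (.seq C (.while φ C)) K σ
      else meanScore 𝔼 n .skip K σ := by
  simp only [meanScore, runScore]
  split_ifs <;> rfl

end

/-! ## Comparison with the weakest liberal preexpectation -/

/-- The weakest liberal preexpectation of a continuation. -/
noncomputable def wlpCont : List (Prog L) → State Var → ℝ≥0∞
  | [] => fun _ => 1
  | C :: K => wlp C (wlpCont K)

theorem isPreexp_wlpCont (K : List (Prog L)) : IsPreexp (wlpCont K) := by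
  induction K with
  | nil => exact IsPreexp.one
  | cons C K ih => exact (wlp_cocontinuous C).isPreexp ih

theorem wlp_splitSeq (C₁ C₂ : Prog L) (f : State Var → ℝ≥0∞) :
    wlp (C₁.splitSeq C₂).1 (wlp (C₁.splitSeq C₂).2 f) = wlp C₁ (wlp C₂ f) := by
  induction C₁ generalizing C₂ with
  | seq A B ihA _ => exact ihA (.seq B C₂)
  | _ => rfl

/-- The induction is on the number of steps, because unfolding a loop yields a larger program. -/
theorem wlp_le_meanScore (𝔼 : EntropySpace S) (n : ℕ) (C : Prog L) (K : List (Prog L)) :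
    wlp C (wlpCont K) ≤ meanScore 𝔼 n C K := by
  induction n generalizing C K with
  | zero =>
    intro σ
    rw [meanScore_zero]
    exact ((wlp_cocontinuous C).isPreexp (isPreexp_wlpCont K)).le_one σ
  | succ n ih =>
    intro σ
    cases C with
    | skip =>
      cases K with
      | nil => rw [meanScore_final]; exact le_rfl
      | cons C K => rw [meanScore_pop]; exact ih C K σ
    | diverge => rw [meanScore_diverge]; exact le_rfl
    | assign x E => exact ih .skip K _
    | draw x =>
      rw [meanScore_draw]
      exact lintegral_mono fun v => ih .skip K _
    | observe φ =>
      rw [meanScore_observe, wlp]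
      dsimp only
      split_ifs
      exacts [ih .skip K σ, le_rfl]
    | score E =>
      rw [meanScore_score, wlp]
      dsimp only
      split_ifs
      exacts [mul_le_mul_right (ih .skip K σ) _, le_rfl]
    | seq C₁ C₂ =>
      rw [meanScore_seq, wlp, ← wlp_splitSeq]
      exact ih _ (_ :: K) σ
    | ite φ C =>
      rw [meanScore_ite, wlp]
      dsimp only
      split_ifs
      exacts [ih C K σ, ih .skip K σ]
    | _ =>
      rename_i φ C
      rw [meanScore_while, wlp_while φ C (isPreexp_wlpCont K)]
      dsimp only
      split_ifs
      exacts [ih (.seq C (.while φ C)) K σ, ih .skip K σ]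

/-- The limit of the mean scores. -/
noncomputable def limScore (𝔼 : EntropySpace S) (C : Prog L) (K : List (Prog L)) :
    State Var → ℝ≥0∞ :=
  ⨅ n, meanScore 𝔼 n C K

section

variable (𝔼 : EntropySpace S) (K : List (Prog L))

theorem isPreexp_limScore (C : Prog L) : IsPreexp (limScore 𝔼 C K) :=
  IsPreexp.iInf fun n => isPreexp_meanScore 𝔼 n K C

theorem limScore_eq_iInf_succ (C : Prog L) :
    limScore 𝔼 C K = ⨅ n, meanScore 𝔼 (n + 1) C K :=
  ((meanScore_antitone 𝔼 K C).iInf_nat_add 1).symm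

theorem limScore_eq_wlp {C : Prog L} (h : ∀ n, meanScore 𝔼 (n + 1) C K =
    wlp C (meanScore 𝔼 n .skip K)) : limScore 𝔼 C K = wlp C (limScore 𝔼 .skip K) := by
  rw [limScore_eq_iInf_succ, limScore, (wlp_cocontinuous C).map_iInf
    (fun n => isPreexp_meanScore 𝔼 n K .skip) (meanScore_antitone 𝔼 K .skip)]
  exact iInf_congr h

theorem limScore_pop (C : Prog L) : limScore 𝔼 .skip (C :: K) = limScore 𝔼 C K := by
  rw [limScore_eq_iInf_succ]
  exact iInf_congr fun n => funext fun σ => meanScore_pop 𝔼 n K σ C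

theorem limScore_seq (C₁ C₂ : Prog L) : limScore 𝔼 (.seq C₁ C₂) K =
    limScore 𝔼 (C₁.splitSeq C₂).1 ((C₁.splitSeq C₂).2 :: K) := by
  rw [limScore_eq_iInf_succ]
  exact iInf_congr fun n => funext fun σ => meanScore_seq 𝔼 n K σ C₁ C₂

theorem limScore_ite (φ : L.Pred) (C : Prog L) : limScore 𝔼 (.ite φ C) K =
    fun σ => if L.evalP φ σ = true then limScore 𝔼 C K σ else limScore 𝔼 .skip K σ := by
  rw [limScore_eq_iInf_succ]
  funext σ
  simp only [limScore, iInf_apply, meanScore_ite]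
  split_ifs <;> rfl

theorem limScore_while (φ : L.Pred) (C : Prog L) : limScore 𝔼 (.while φ C) K =
    fun σ => if L.evalP φ σ = true then limScore 𝔼 (.seq C (.while φ C)) K σ
      else limScore 𝔼 .skip K σ := by
  rw [limScore_eq_iInf_succ]
  funext σ
  simp only [limScore, iInf_apply, meanScore_while]
  split_ifs <;> rfl

end

/-- The second conjunct strengthens the induction: a loop unfolds to its body followed by the loop
itself, so the hypothesis on the body must allow an arbitrary successor `D`. -/
theorem limScore_le_wlp (𝔼 : EntropySpace S) (C : Prog L) :
    (∀ K, limScore 𝔼 C K ≤ wlp C (limScore 𝔼 .skip K)) ∧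
      ∀ D K, limScore 𝔼 (.seq C D) K ≤ wlp C (limScore 𝔼 D K) := by
  -- For a statement that is not a sequence, the successor `D` is simply pushed onto the
  -- continuation, so the first conjunct at `D :: K` gives the second.
  have key {C : Prog L} (hC : ∀ D, C.splitSeq D = (C, D))
      (h : ∀ K, limScore 𝔼 C K ≤ wlp C (limScore 𝔼 .skip K)) :
      (∀ K, limScore 𝔼 C K ≤ wlp C (limScore 𝔼 .skip K)) ∧
        ∀ D K, limScore 𝔼 (.seq C D) K ≤ wlp C (limScore 𝔼 D K) := by
    refine ⟨h, fun D K => ?_⟩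
    rw [limScore_seq, hC, ← limScore_pop 𝔼 K D]
    exact h (D :: K)
  induction C with
  | skip => exact key (fun _ => rfl) fun K => le_rfl
  | diverge => exact key (fun _ => rfl) fun K => (isPreexp_limScore 𝔼 K .diverge).le_one
  | assign x E => exact key (fun _ => rfl) fun K => (limScore_eq_wlp 𝔼 K fun n => rfl).le
  | draw x =>
    exact key (fun _ => rfl) fun K =>
      (limScore_eq_wlp 𝔼 K fun n => funext fun σ => meanScore_draw 𝔼 n K σ x).le
  | observe φ =>
    exact key (fun _ => rfl) fun K =>
      (limScore_eq_wlp 𝔼 K fun n => funext fun σ => meanScore_observe 𝔼 n K σ φ).le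
  | score E =>
    exact key (fun _ => rfl) fun K =>
      (limScore_eq_wlp 𝔼 K fun n => funext fun σ => meanScore_score 𝔼 n K σ E).le
  | seq A B ihA ihB =>
    have hA := wlp_cocontinuous A
    have hB := wlp_cocontinuous B
    refine ⟨fun K => (ihA.2 B K).trans ?_, fun D K => ?_⟩
    · exact hA.mono (isPreexp_limScore 𝔼 K B) (hB.isPreexp (isPreexp_limScore 𝔼 K .skip))
        (ihB.1 K)
    -- Both bracketings split into the same first statement and remainder, so their limits agree.
    · have h : limScore 𝔼 (.seq (.seq A B) D) K = limScore 𝔼 (.seq A (.seq B D)) K := by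
        rw [limScore_seq, limScore_seq, Prog.splitSeq]
      rw [h]
      exact (ihA.2 (.seq B D) K).trans (hA.mono (isPreexp_limScore 𝔼 K _)
        (hB.isPreexp (isPreexp_limScore 𝔼 K D)) (ihB.2 D K))
  | ite φ C ih =>
    refine key (fun _ => rfl) fun K => ?_
    rw [limScore_ite]
    intro σ
    simp only [wlp]
    split_ifs
    exacts [ih.1 K σ, le_rfl]
  | _ =>
    rename_i φ C ih
    refine key (fun _ => rfl) fun K => le_wlp_while φ C (isPreexp_limScore 𝔼 K .skip)
      (isPreexp_limScore 𝔼 K _) ?_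
    intro σ
    conv_lhs => rw [limScore_while]
    dsimp only
    split_ifs
    exacts [ih.2 (.while φ C) K σ, le_rfl]

theorem limScore_nil (𝔼 : EntropySpace S) (C : Prog L) :
    limScore 𝔼 C [] = wlp C fun _ => 1 := by
  refine le_antisymm ?_ (le_iInf fun n => wlp_le_meanScore 𝔼 n C [])
  refine ((limScore_le_wlp 𝔼 C).1 []).trans_eq ?_
  congr 1
  funext σ
  simp [limScore, iInf_apply, meanScore_final]

end PL

theorem mainTheorem3 {Var : Type*} [Countable Var] [DecidableEq Var] (L : PL.ExprLang Var)
    {S : Type*} [MeasurableSpace S] (𝔼 : PL.EntropySpace S)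
    (C : PL.Prog L) (σ : PL.State Var) :
    Measurable (fun θ => PL.SC 𝔼 C (.proper σ) θ) ∧
      PL.wlp C (fun _ => 1) σ = ∫⁻ θ, (PL.SC 𝔼 C (.proper σ) θ : ℝ≥0∞) ∂𝔼.μ := by
  have := 𝔼.isProbabilityMeasure
  -- The irrelevant continuation entropy is taken to be `θ` itself, so no element of `S` has to be
  -- chosen.
  have hm (n : ℕ) : Measurable fun θ => PL.runScore 𝔼 n C [] θ σ θ :=
    (PL.measurable_runScore 𝔼 n C []).comp
      (measurable_id.prodMk (measurable_const.prodMk measurable_id))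
  have hSC : (fun θ => PL.SC 𝔼 C (.proper σ) θ) =
      fun θ => ⨅ n, PL.runScore 𝔼 n C [] θ σ θ := by
    funext θ
    exact iInf_congr fun n => PL.scoreAt_eq 𝔼 C σ θ θ n
  have hmean (n : ℕ) : PL.meanScore 𝔼 n C [] σ =
      ∫⁻ θ, (PL.runScore 𝔼 n C [] θ σ θ : ℝ≥0∞) ∂𝔼.μ := by
    have h (θK : S) : ∫⁻ θ, (PL.runScore 𝔼 n C [] θ σ θK : ℝ≥0∞) ∂𝔼.μ =
        ∫⁻ θ, (PL.runScore 𝔼 n C [] θ σ θ : ℝ≥0∞) ∂𝔼.μ :=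
      lintegral_congr fun θ => congrArg _ (PL.runScore_congr 𝔼 n C [] θ σ trivial)
    rw [PL.meanScore, lintegral_congr h, lintegral_const, measure_univ, mul_one]
  refine ⟨hSC ▸ Measurable.iInf hm, ?_⟩
  rw [← PL.limScore_nil 𝔼 C, PL.limScore, iInf_apply]
  simp_rw [congrFun hSC, ENNReal.coe_iInf, hmean]
  refine (lintegral_iInf (fun n => (hm n).coe_nnreal_ennreal) (fun m n hmn θ => ?_) ?_).symm
  · exact ENNReal.coe_le_coe.2 (PL.runScore_antitone 𝔼 C [] θ σ θ hmn)
  · rw [← hmean]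
    exact ne_top_of_le_ne_top ENNReal.one_ne_top (PL.meanScore_le_one 𝔼 0 [] σ C)
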